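/- Let $L=\{+,0\}$ be the vocabulary of groups. For infinite cardinals $\lambda\le\kappa$ let $L_{\kappa\lambda}$ be the infinitary language built from the atomic $L$-formulas by negation, conjunctions and disjunctions of fewer than $\kappa$ formulas, and existential and universal quantifier strings of length less than $\lambda$; let $L_{\infty\lambda}$ be the union of the $L_{\kappa\lambda}$ over all infinite cardinals $\kappa\ge\lambda$. Two groups are $L_{\kappa\lambda}$-equivalent (respectively $L_{\infty\lambda}$-equivalent) if they satisfy the same sentences of $L_{\kappa\lambda}$ (respectively $L_{\infty\lambda}$). An abelian group $G$ is slender if it is torsion-free and, for every homomorphism $h:\mathbb{Z}^\omega\to G$, $h(e_n)=0$ for all but finitely many $n$, where $e_n$ is the $n$-th standard unit vector. Corollary 0.2. The Baer–Specker group $\mathbb{Z}^\omega$ (the product of countably many copies of $\mathbb{Z}$) is not $L_{\infty\omega_1}$-equivalent to any slender abelian group. In fact, it is not even $L_{(2^{\aleph_0})^+\aleph_1}$-equivalent to any slender abelian group. -/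

import Mathlib

open Cardinal

universe u v w u₁ u₂

/-- Function symbols of the vocabulary of groups: a constant `0` and a binary symbol `+`. -/
inductive GroupFunctions : ℕ → Type
  | zero : GroupFunctions 0
  | add : GroupFunctions 2

/-- The vocabulary of (abelian) groups `{+, 0}`, with no relation symbols besides equality. -/
def groupLanguage : FirstOrder.Language.{0, 0} :=
  ⟨GroupFunctions, fun _ => Empty⟩

/-- Every additive abelian group is a structure for the vocabulary of groups. -/
instance groupStructure (G : Type u) [AddCommGroup G] : groupLanguage.Structure G where
  funMap := fun {_} f => match f with
    | .zero => fun _ => 0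
    | .add => fun x => x 0 + x 1
  RelMap := fun {_} r => Empty.elim r

/-- Infinitary formulas over the vocabulary `L` with free variables in `α`. Conjunctions and
disjunctions are over arbitrary index sets; a quantifier binds a string of variables indexed by
an arbitrary set `β`, so that its body has free variables in `α ⊕ β`. -/
inductive InfFormula (L : FirstOrder.Language.{u, v}) : Type w → Type (max u v (w + 1))
  | equal {α : Type w} (t₁ t₂ : L.Term α) : InfFormula L α
  | rel {α : Type w} {n : ℕ} (R : L.Relations n) (ts : Fin n → L.Term α) : InfFormula L α
  | not {α : Type w} (φ : InfFormula L α) : InfFormula L α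
  | conj {α : Type w} (ι : Type w) (φ : ι → InfFormula L α) : InfFormula L α
  | disj {α : Type w} (ι : Type w) (φ : ι → InfFormula L α) : InfFormula L α
  | ex {α : Type w} (β : Type w) (φ : InfFormula L (α ⊕ β)) : InfFormula L α
  | all {α : Type w} (β : Type w) (φ : InfFormula L (α ⊕ β)) : InfFormula L α

namespace InfFormula

/-- Satisfaction of an infinitary formula in a structure `M` under an assignment `s`. -/
def Realize {L : FirstOrder.Language.{u, v}} (M : Type u₁) [L.Structure M] :
    {α : Type w} → InfFormula L α → (α → M) → Prop
  | _, equal t₁ t₂, s => t₁.realize s = t₂.realize s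
  | _, rel R ts, s => FirstOrder.Language.Structure.RelMap R (fun i => (ts i).realize s)
  | _, not φ, s => ¬ Realize M φ s
  | _, conj _ φ, s => ∀ i, Realize M (φ i) s
  | _, disj _ φ, s => ∃ i, Realize M (φ i) s
  | _, ex β φ, s => ∃ b : β → M, Realize M φ (Sum.elim s b)
  | _, all β φ, s => ∀ b : β → M, Realize M φ (Sum.elim s b)

/-- `φ.InLogic κ l` says that `φ` is a formula of `L_{κ l}`: all conjunctions and disjunctions in
it have fewer than `κ` members, and all quantifier strings have length less than `l`. -/
def InLogic {L : FirstOrder.Language.{u, v}} (κ l : Cardinal.{w}) :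
    {α : Type w} → InfFormula L α → Prop
  | _, equal _ _ => True
  | _, rel _ _ => True
  | _, not φ => InLogic κ l φ
  | _, conj ι φ => #ι < κ ∧ ∀ i, InLogic κ l (φ i)
  | _, disj ι φ => #ι < κ ∧ ∀ i, InLogic κ l (φ i)
  | _, ex β φ => #β < l ∧ InLogic κ l φ
  | _, all β φ => #β < l ∧ InLogic κ l φ

/-- `φ` is a formula of `L_{∞ l}`, the union of the `L_{κ l}` over all infinite cardinals
`κ ≥ l`. -/
def InLogicInfty {L : FirstOrder.Language.{u, v}} (l : Cardinal.{w}) {α : Type w}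
    (φ : InfFormula L α) : Prop :=
  ∃ κ : Cardinal.{w}, ℵ₀ ≤ κ ∧ l ≤ κ ∧ φ.InLogic κ l

end InfFormula

/-- Infinitary sentences: formulas without free variables. -/
abbrev InfSentence (L : FirstOrder.Language.{u, v}) : Type (max u v (w + 1)) :=
  InfFormula.{u, v, w} L PEmpty.{w + 1}

/-- The sentence `φ` holds in `M`. -/
def InfSentence.Holds {L : FirstOrder.Language.{u, v}} (φ : InfSentence.{u, v, w} L)
    (M : Type u₁) [L.Structure M] : Prop :=
  InfFormula.Realize M φ PEmpty.elim

/-- `A ≡_{κ l} B`: the structures `A` and `B` satisfy the same sentences of `L_{κ l}`. -/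
def InfEquiv (L : FirstOrder.Language.{u, v}) (κ l : Cardinal.{w}) (A : Type u₁) (B : Type u₂)
    [L.Structure A] [L.Structure B] : Prop :=
  ∀ φ : InfSentence.{u, v, w} L, φ.InLogic κ l → (φ.Holds A ↔ φ.Holds B)

/-- `A ≡_{∞ l} B`: the structures `A` and `B` satisfy the same sentences of `L_{∞ l}`. -/
def InfEquivInfty (L : FirstOrder.Language.{u, v}) (l : Cardinal.{w}) (A : Type u₁) (B : Type u₂)
    [L.Structure A] [L.Structure B] : Prop :=
  ∀ φ : InfSentence.{u, v, w} L, φ.InLogicInfty l → (φ.Holds A ↔ φ.Holds B)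

/-- The Baer–Specker group `ℤ^ω`. -/
abbrev BaerSpecker : Type := ℕ → ℤ

/-- An abelian group `G` is slender if it is torsion-free and every homomorphism from `ℤ^ω` to `G`
sends all but finitely many of the standard unit vectors to `0`. -/
structure IsSlender (G : Type u) [AddCommGroup G] : Prop where
  torsionFree : IsAddTorsionFree G
  finite_support : ∀ h : BaerSpecker →+ G, {n : ℕ | h (Pi.single n 1) ≠ 0}.Finite

/-! Two sentences separate `ℤ^ω` from slender groups. In `ℤ^ω` only `0` is divisible by all
factorials, while every series `∑ n! a_n e_n` has a sum. If a slender `G` agreed on both, it would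
have nonzero `y_n` whose series all have unique sums; then `a ↦ ∑ n! a_n y_n` is a homomorphism from
`ℤ^ω` sending `e_n` to `n! y_n`, nonzero as `G` is torsion-free, a contradiction
(`IsSlender.exists_not_isFactorialSum`). -/

open FirstOrder FirstOrder.Language

namespace groupLanguage

/-- The constant `0` as a term. -/
def zeroTerm {α : Type w} : groupLanguage.Term α :=
  Term.func GroupFunctions.zero ![]

/-- The sum of two terms. -/
def addTerm {α : Type w} (s t : groupLanguage.Term α) : groupLanguage.Term α :=
  Term.func GroupFunctions.add ![s, t]

/-- The finite sum `t 0 + ⋯ + t (k - 1)`. -/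
def sumTerm {α : Type w} (t : ℕ → groupLanguage.Term α) : ℕ → groupLanguage.Term α
  | 0 => zeroTerm
  | k + 1 => addTerm (sumTerm t k) (t k)

/-- The multiple `n • t` of a term. -/
def nsmulTerm {α : Type w} (n : ℕ) (t : groupLanguage.Term α) : groupLanguage.Term α :=
  sumTerm (fun _ => t) n

section Realize

variable {G : Type u} [AddCommGroup G] {α : Type w} (v : α → G)

@[simp]
theorem realize_zeroTerm : (zeroTerm : groupLanguage.Term α).realize v = 0 := rfl

@[simp]
theorem realize_addTerm (s t : groupLanguage.Term α) :
    (addTerm s t).realize v = s.realize v + t.realize v := rfl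

@[simp]
theorem realize_sumTerm (t : ℕ → groupLanguage.Term α) (k : ℕ) :
    (sumTerm t k).realize v = ∑ i ∈ Finset.range k, (t i).realize v := by
  induction k with
  | zero => rfl
  | succ k ih => rw [sumTerm, realize_addTerm, ih, Finset.sum_range_succ]

@[simp]
theorem realize_nsmulTerm (n : ℕ) (t : groupLanguage.Term α) :
    (nsmulTerm n t).realize v = n • t.realize v := by
  simp [nsmulTerm]

end Realize

end groupLanguage

open groupLanguage

/-! ### Factorial series and slenderness -/

/-- `x` is the sum of the series `∑ n! a_n y_n` in the sense of divisibility by factorials. -/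
def IsFactorialSum {G : Type u} [AddCommGroup G] (y : ℕ → G) (a : ℕ → ℤ) (x : G) : Prop :=
  ∀ k : ℕ, ∃ z : G, x = k.factorial • z + ∑ n ∈ Finset.range k, (n.factorial * a n) • y n

namespace IsFactorialSum

variable {G : Type u} [AddCommGroup G] {y : ℕ → G}

theorem add {a b : ℕ → ℤ} {x x' : G} (h : IsFactorialSum y a x) (h' : IsFactorialSum y b x') :
    IsFactorialSum y (a + b) (x + x') := by
  intro k
  obtain ⟨z, hz⟩ := h k
  obtain ⟨z', hz'⟩ := h' k
  refine ⟨z + z', ?_⟩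
  simp only [hz, hz', Pi.add_apply, mul_add, add_smul, smul_add, Finset.sum_add_distrib]
  abel

/-- The partial sums cancel; this yields uniqueness of sums when only `0` is divisible by all
factorials. -/
theorem sub_divisible {a : ℕ → ℤ} {x x' : G} (h : IsFactorialSum y a x)
    (h' : IsFactorialSum y a x') (k : ℕ) : ∃ z : G, x - x' = k.factorial • z := by
  obtain ⟨z, hz⟩ := h k
  obtain ⟨z', hz'⟩ := h' k
  exact ⟨z - z', by rw [hz, hz', smul_sub]; abel⟩

theorem single (y : ℕ → G) (m : ℕ) :
    IsFactorialSum y (Pi.single m 1) (m.factorial • y m) := by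
  intro k
  rcases lt_or_ge m k with hmk | hkm
  · refine ⟨0, ?_⟩
    rw [Finset.sum_eq_single_of_mem m (Finset.mem_range.2 hmk)]
    · simp
    · intro n _ hn
      simp [hn]
  -- The `m`-th term is not yet in the partial sum, so `k!` must divide `m!`.
  · obtain ⟨c, hc⟩ := Nat.factorial_dvd_factorial hkm
    refine ⟨c • y m, ?_⟩
    rw [Finset.sum_eq_zero, add_zero, hc, mul_smul]
    intro n hn
    have : n ≠ m := by
      have := Finset.mem_range.1 hn
      omega
    simp [this]

/-- In `ℤ^ω`, the series `∑ n! a_n e_n` has a sum. -/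
theorem baerSpecker (a : ℕ → ℤ) :
    IsFactorialSum (fun n => (Pi.single n 1 : BaerSpecker)) a fun n => n.factorial * a n := by
  intro k
  -- The tail of the series divided by `k!`; the division is exact for `i ≥ k`.
  refine ⟨fun i => if i < k then 0 else (i.factorial / k.factorial : ℕ) * a i, ?_⟩
  funext i
  simp only [Pi.add_apply, Pi.smul_apply, Finset.sum_apply, Pi.single_apply, smul_ite, smul_zero,
    smul_eq_mul, mul_ite, mul_one, mul_zero, Finset.sum_ite_eq, Finset.mem_range]
  split_ifs with h
  · rw [zero_add]
  · rw [add_zero, nsmul_eq_mul, ← mul_assoc, ← Nat.cast_mul,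
      Nat.mul_div_cancel' (Nat.factorial_dvd_factorial (not_lt.1 h))]

end IsFactorialSum

/-- The group `ℤ^ω` has no nonzero element divisible by all factorials. -/
theorem BaerSpecker.eq_zero_of_divisible (x : BaerSpecker)
    (hx : ∀ k : ℕ, ∃ z : BaerSpecker, x = k.factorial • z) : x = 0 := by
  funext i
  -- This factorial exceeds `|x i|` and divides `x i`.
  obtain ⟨z, hz⟩ := hx ((x i).natAbs + 1)
  refine Int.eq_zero_of_abs_lt_dvd (m := (((x i).natAbs + 1).factorial : ℤ)) ⟨z i, ?_⟩ ?_
  · simpa using congrFun hz i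
  · have := Nat.self_le_factorial ((x i).natAbs + 1)
    rw [Int.abs_eq_natAbs]
    exact_mod_cast this

/-- A slender group without nonzero elements divisible by all factorials has no sequence of nonzero
elements all of whose series `∑ n! a_n y_n` have a sum. -/
theorem IsSlender.exists_not_isFactorialSum {G : Type u} [AddCommGroup G] (hG : IsSlender G)
    (hred : ∀ x : G, (∀ k : ℕ, ∃ z : G, x = k.factorial • z) → x = 0)
    (y : ℕ → G) (hy : ∀ n, y n ≠ 0) : ∃ a : ℕ → ℤ, ∀ x, ¬ IsFactorialSum y a x := by
  by_contra! hsum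
  choose h hh using hsum
  have huniq : ∀ {a : ℕ → ℤ} {x : G}, IsFactorialSum y a x → h a = x := fun {a x} hx =>
    sub_eq_zero.1 (hred _ fun k => (hh a).sub_divisible hx k)
  -- Uniqueness of sums makes the choice `h` additive.
  let f : BaerSpecker →+ G := AddMonoidHom.mk' h fun a b => huniq ((hh a).add (hh b))
  have := hG.torsionFree
  have hf : ∀ n, f (Pi.single n 1) ≠ 0 := fun n => by
    rw [show f (Pi.single n 1) = n.factorial • y n from huniq (IsFactorialSum.single y n)]
    exact fun h0 => hy n ((nsmul_eq_zero_iff_right n.factorial_ne_zero).1 h0)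
  exact Set.infinite_univ (α := ℕ) ((hG.finite_support f).subset fun n _ => hf n)

/-! ### The two separating sentences -/

namespace InfFormula

/-- The sentence saying that some nonzero element is divisible by all factorials. -/
def existsDivisible : InfSentence.{0, 0, w} groupLanguage :=
  ex PUnit (conj (ULift (Option ℕ)) fun i => match i.down with
    | none => not (equal (.var (.inr ⟨⟩)) zeroTerm)
    | some k => ex PUnit (equal (.var (.inl (.inr ⟨⟩)))
        (nsmulTerm k.factorial (.var (.inr ⟨⟩)))))

/-- The sentence saying that there is a sequence of nonzero elements all of whose series
`∑ n! a_n y_n` have a sum. -/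
def existsSummable : InfSentence.{0, 0, w} groupLanguage :=
  ex (ULift ℕ) (conj (ULift (ℕ ⊕ (ℕ → ℤ))) fun i => match i.down with
    | .inl n => not (equal (.var (.inr ⟨n⟩)) zeroTerm)
    | .inr a => ex PUnit (conj (ULift ℕ) fun k => ex PUnit (equal
        (addTerm (.var (.inl (.inr ⟨⟩))) (sumTerm (fun n =>
          nsmulTerm (n.factorial * (-a n).toNat) (.var (.inl (.inl (.inr ⟨n⟩))))) k.down))
        (addTerm (nsmulTerm k.down.factorial (.var (.inr ⟨⟩))) (sumTerm (fun n =>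
          nsmulTerm (n.factorial * (a n).toNat) (.var (.inl (.inl (.inr ⟨n⟩))))) k.down)))))

theorem holds_existsDivisible (G : Type u) [AddCommGroup G] :
    existsDivisible.{w}.Holds G ↔ ∃ x : G, x ≠ 0 ∧ ∀ k : ℕ, ∃ z : G, x = k.factorial • z := by
  constructor
  · rintro ⟨b, hb⟩
    refine ⟨b ⟨⟩, hb ⟨none⟩, fun k => ?_⟩
    obtain ⟨c, hc⟩ := hb ⟨some k⟩
    refine ⟨c ⟨⟩, ?_⟩
    simpa [Realize] using hc
  · rintro ⟨x, hx, hk⟩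
    refine ⟨fun _ => x, ?_⟩
    rintro ⟨_ | k⟩
    · exact hx
    · obtain ⟨z, hz⟩ := hk k
      refine ⟨fun _ => z, ?_⟩
      simpa [Realize] using hz

/-- Terms in `+` and `0` express only natural multiples, so each `a n` is split into positive and
negative parts and the negative ones move to the left side. -/
theorem factorialSum_eq_iff {G : Type u} [AddCommGroup G] (y : ℕ → G) (a : ℕ → ℤ) (x w : G)
    (k : ℕ) :
    x + ∑ n ∈ Finset.range k, (n.factorial * (-a n).toNat) • y n =
        w + ∑ n ∈ Finset.range k, (n.factorial * (a n).toNat) • y n ↔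
      x = w + ∑ n ∈ Finset.range k, (n.factorial * a n) • y n := by
  have hsplit : ∑ n ∈ Finset.range k, (n.factorial * (a n).toNat) • y n =
      ∑ n ∈ Finset.range k, (n.factorial * a n) • y n +
        ∑ n ∈ Finset.range k, (n.factorial * (-a n).toNat) • y n := by
    rw [← Finset.sum_add_distrib]
    refine Finset.sum_congr rfl fun n _ => ?_
    rw [← natCast_zsmul, ← natCast_zsmul (y n) (_ * (-a n).toNat), ← add_smul]
    congr 1
    push_cast [← mul_add]
    congr 1
    omega
  rw [hsplit, ← add_assoc, add_left_inj]

theorem holds_existsSummable (G : Type u) [AddCommGroup G] :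
    existsSummable.{w}.Holds G ↔
      ∃ y : ℕ → G, (∀ n, y n ≠ 0) ∧ ∀ a : ℕ → ℤ, ∃ x, IsFactorialSum y a x := by
  constructor
  · rintro ⟨b, hb⟩
    refine ⟨fun n => b ⟨n⟩, fun n => hb ⟨.inl n⟩, fun a => ?_⟩
    obtain ⟨c, hc⟩ := hb ⟨.inr a⟩
    refine ⟨c ⟨⟩, fun k => ?_⟩
    obtain ⟨d, hd⟩ := hc ⟨k⟩
    refine ⟨d ⟨⟩, (factorialSum_eq_iff _ _ _ _ _).1 ?_⟩
    simpa [Realize] using hd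
  · rintro ⟨y, hy, hsum⟩
    refine ⟨fun n => y n.down, ?_⟩
    rintro ⟨n | a⟩
    · exact hy n
    · obtain ⟨x, hx⟩ := hsum a
      refine ⟨fun _ => x, fun k => ?_⟩
      obtain ⟨z, hz⟩ := hx k.down
      refine ⟨fun _ => z, ?_⟩
      simpa [Realize] using (factorialSum_eq_iff _ _ _ _ _).2 hz

theorem inLogic_existsDivisible {κ l : Cardinal.{w}} (hκ : ℵ₀ < κ) (hl : ℵ₀ < l) :
    existsDivisible.InLogic κ l := by
  have h1 : #PUnit.{w + 1} < l := by simpa using one_lt_aleph0.trans hl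
  refine ⟨h1, by simpa using hκ, ?_⟩
  rintro ⟨_ | k⟩
  · trivial
  · exact ⟨h1, trivial⟩

/-- The conjunction over all `a : ℕ → ℤ` has `2 ^ ℵ₀` members, and choosing the sequence `y` takes a
quantifier string of length `ℵ₀`; hence the two bounds. -/
theorem inLogic_existsSummable {κ l : Cardinal.{w}} (hκ : 2 ^ ℵ₀ < κ) (hl : ℵ₀ < l) :
    existsSummable.InLogic κ l := by
  have h1 : #PUnit.{w + 1} < l := by simpa using one_lt_aleph0.trans hl
  have h0 : ℵ₀ < κ := (cantor ℵ₀).trans hκ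
  refine ⟨by simpa using hl, ?_, ?_⟩
  · simpa using hκ
  · rintro ⟨n | a⟩
    · trivial
    · exact ⟨h1, by simpa using h0, fun k => ⟨h1, trivial⟩⟩

end InfFormula

theorem BaerSpecker.not_holds_existsDivisible :
    ¬ InfFormula.existsDivisible.{w}.Holds BaerSpecker := by
  rw [InfFormula.holds_existsDivisible]
  rintro ⟨x, hx, hdiv⟩
  exact hx (BaerSpecker.eq_zero_of_divisible x hdiv)

theorem BaerSpecker.holds_existsSummable : InfFormula.existsSummable.{w}.Holds BaerSpecker :=
  (InfFormula.holds_existsSummable _).2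
    ⟨fun n => Pi.single n 1, fun n => by simp, fun a => ⟨_, IsFactorialSum.baerSpecker a⟩⟩

theorem IsSlender.not_infEquiv_baerSpecker {G : Type u} [AddCommGroup G] (hG : IsSlender G)
    {κ l : Cardinal.{w}} (hκ : 2 ^ ℵ₀ < κ) (hl : ℵ₀ < l) :
    ¬ InfEquiv groupLanguage κ l BaerSpecker G := by
  intro h
  have hdiv := (h _ (InfFormula.inLogic_existsDivisible ((cantor ℵ₀).trans hκ) hl)).not.1
    BaerSpecker.not_holds_existsDivisible
  have hsum := (h _ (InfFormula.inLogic_existsSummable hκ hl)).1 BaerSpecker.holds_existsSummable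
  rw [InfFormula.holds_existsDivisible] at hdiv
  obtain ⟨y, hy, hsum⟩ := (InfFormula.holds_existsSummable G).1 hsum
  obtain ⟨a, ha⟩ := hG.exists_not_isFactorialSum
    (fun x hx => by_contra fun hne => hdiv ⟨x, hne, hx⟩) y hy
  obtain ⟨x, hx⟩ := hsum a
  exact ha x hx

theorem InfEquivInfty.infEquiv {L : FirstOrder.Language.{u, v}} {κ l : Cardinal.{w}}
    {A : Type u₁} {B : Type u₂} [L.Structure A] [L.Structure B] (h : InfEquivInfty L l A B)
    (hκ : ℵ₀ ≤ κ) (hl : l ≤ κ) : InfEquiv L κ l A B :=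
  fun φ hφ => h φ ⟨κ, hκ, hl, hφ⟩

theorem corollary0p2 (G : Type u) [AddCommGroup G] (hG : IsSlender G) :
    ¬ InfEquivInfty groupLanguage (ℵ₁ : Cardinal.{w}) BaerSpecker G ∧
      ¬ InfEquiv groupLanguage (Order.succ ((2 : Cardinal.{w}) ^ (ℵ₀ : Cardinal.{w}))) ℵ₁
        BaerSpecker G := by
  have hκ : (2 : Cardinal.{w}) ^ (ℵ₀ : Cardinal.{w}) < Order.succ (2 ^ ℵ₀) := Order.lt_succ _
  have hnot := hG.not_infEquiv_baerSpecker hκ aleph0_lt_aleph_one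
  -- The first claim reduces to the second, since `ℵ₁ ≤ (2 ^ ℵ₀)⁺`.
  refine ⟨fun h => hnot (h.infEquiv ((cantor ℵ₀).trans hκ).le ?_), hnot⟩
  rw [← succ_aleph0]
  exact Order.succ_le_succ (cantor ℵ₀).le
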